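/- Let $R_{4,4}$ be the $4\times4$ rook graph, i.e. the Cayley graph on $\mathbb Z/4\mathbb Z\times\mathbb Z/4\mathbb Z$ with generators $\{(0,x),(x,0): x=1,2,3\}$, and let $\mathrm{Shr}$ be the Shrikhande graph, i.e. the Cayley graph on $\mathbb Z/4\mathbb Z\times\mathbb Z/4\mathbb Z$ with generators $\{\pm(0,1),\pm(1,0),\pm(1,1)\}$. For a finite connected graph $G$ with distance $d$, the magnitude $\#G$ is the sum of all entries of the inverse of the matrix $(q^{d(x,y)})_{x,y\in V(G)}$, regarded both as a rational function in $\mathbb Q(q)$ and as a power series in $\mathbb Z[[q]]$. For a sequence of vertices put $\ell(x_0,\ldots,x_k)=\sum_{0\le i\le k-1}d(x_i,x_{i+1})$. Let $\mathrm{MC}_{k,l}(G)$ be the free abelian group on the sequences $(x_0,\ldots,x_k)\in V(G)^{k+1}$ with $x_i\neq x_{i+1}$ for all $i$ and $\ell(x_0,\ldots,x_k)=l$, with differential $\partial=\sum_{1\le i\le k-1}(-1)^i\partial_i:\mathrm{MC}_{k,l}(G)\to\mathrm{MC}_{k-1,l}(G)$, where $\partial_i(x_0,\ldots,x_k)=(x_0,\ldots,\widehat{x_i},\ldots,x_k)$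 if this sequence has length $l$, and $\partial_i(x_0,\ldots,x_k)=0$ otherwise. The magnitude homology of $G$ is $\mathrm{MH}_{k,l}(G)=H_k(\mathrm{MC}_{*,l}(G))$. Then $R_{4,4}$ and $\mathrm{Shr}$ have the same magnitude, namely $$\#R_{4,4}=\#\mathrm{Shr}=\frac{16}{1+6q+9q^2},$$ both as rational functions and as power series, but different magnitude homology: $\mathrm{MH}_{3,4}(R_{4,4})=0$, while $\mathrm{MH}_{3,4}(\mathrm{Shr})$ has nonzero rank (in particular it is nonzero). Hence it is not the case that $\mathrm{MH}_{k,l}(R_{4,4})\cong\mathrm{MH}_{k,l}(\mathrm{Shr})$ for all $k,l$. -/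

import Mathlib

namespace GraphMagnitude

universe u

section Magnitude

variable {V : Type u} (G : SimpleGraph V)

open Classical in
/-- The similarity matrix of `G` at `q`: its entry at `(x, y)` is `q ^ d(x, y)`, with the
convention that this is `0` when `d(x, y) = ∞`. -/
noncomputable def similarityMatrix {R : Type*} [CommRing R] (q : R) : Matrix V V R :=
  Matrix.of fun x y => if G.Reachable x y then q ^ G.dist x y else 0

/-- Setting `q = 0` in the similarity matrix gives the identity matrix. -/
theorem similarityMatrix_map [DecidableEq V] {R S : Type*} [CommRing R] [CommRing S]
    (f : R →+* S) (q : R) (hq : f q = 0) : (similarityMatrix G q).map f = 1 := by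
  ext x y
  simp only [similarityMatrix, Matrix.map_apply, Matrix.of_apply, Matrix.one_apply]
  by_cases hxy : x = y
  · subst hxy; simp
  · by_cases h : G.Reachable x y
    · have : G.dist x y ≠ 0 := fun h0 => hxy (h.dist_eq_zero_iff.mp h0)
      simp [h, hxy, hq, this]
    · simp [h, hxy]

variable [Fintype V] [DecidableEq V]

/-- The sum of all the entries of the inverse of the similarity matrix at `q`. -/
noncomputable def magnitudeAt {R : Type*} [CommRing R] (q : R) : R :=
  ∑ x, ∑ y, (similarityMatrix G q)⁻¹ x y

/-- The magnitude of `G` as a rational function in the variable `q`. -/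
noncomputable def magnitude : RatFunc ℚ :=
  magnitudeAt G RatFunc.X

/-- The magnitude of `G` as a power series with integer coefficients in the variable `q`. -/
noncomputable def magnitudeSeries : PowerSeries ℤ :=
  magnitudeAt G PowerSeries.X

/-- The similarity matrix is invertible over `ℤ⟦q⟧`, so that the inverse is a true inverse. -/
theorem isUnit_det_similarityMatrix_series :
    IsUnit (similarityMatrix G (PowerSeries.X : PowerSeries ℤ)).det := by
  rw [PowerSeries.isUnit_iff_constantCoeff]
  have h := similarityMatrix_map G (PowerSeries.constantCoeff (R := ℤ)) PowerSeries.X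
    PowerSeries.constantCoeff_X
  have h2 := RingHom.map_det (PowerSeries.constantCoeff (R := ℤ))
    (similarityMatrix G (PowerSeries.X : PowerSeries ℤ))
  rw [RingHom.mapMatrix_apply, h, Matrix.det_one] at h2
  rw [h2]
  exact isUnit_one

/-- The similarity matrix is invertible over `ℚ(q)`, so that the inverse is a true inverse. -/
theorem isUnit_det_similarityMatrix_ratFunc :
    IsUnit (similarityMatrix G (RatFunc.X : RatFunc ℚ)).det := by
  rw [isUnit_iff_ne_zero]
  have h := similarityMatrix_map G (Polynomial.constantCoeff (R := ℚ)) Polynomial.X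
    (by simp)
  have h2 := RingHom.map_det (Polynomial.constantCoeff (R := ℚ))
    (similarityMatrix G (Polynomial.X : Polynomial ℚ))
  rw [RingHom.mapMatrix_apply, h, Matrix.det_one] at h2
  have h3 := RingHom.map_det (algebraMap (Polynomial ℚ) (RatFunc ℚ))
    (similarityMatrix G (Polynomial.X : Polynomial ℚ))
  have h4 : (algebraMap (Polynomial ℚ) (RatFunc ℚ)).mapMatrix
      (similarityMatrix G (Polynomial.X : Polynomial ℚ)) =
      similarityMatrix G (RatFunc.X : RatFunc ℚ) := by
    ext x y
    simp only [similarityMatrix, RingHom.mapMatrix_apply, Matrix.map_apply, Matrix.of_apply]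
    split_ifs <;> simp
  rw [← h4, ← h3]
  intro h0
  rw [map_eq_zero_iff _ (RatFunc.algebraMap_injective ℚ)] at h0
  rw [h0] at h2
  simp at h2

end Magnitude

section Homology

variable {V : Type u} (G : SimpleGraph V)

/-- The length `ℓ(x₀, …, x_k) = ∑ d(x_i, x_{i+1})` of a sequence of vertices; it is infinite when
two consecutive vertices lie in different connected components. -/
noncomputable def length {k : ℕ} (x : Fin (k + 1) → V) : ℕ∞ :=
  ∑ i : Fin k, G.edist (x i.castSucc) (x i.succ)

/-- The generators of `MC_{k,l}(G)`: the sequences `(x₀, …, x_k)` of length `l` in which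
consecutive vertices are distinct. -/
def Gen (k l : ℕ) : Type u :=
  {x : Fin (k + 1) → V // (∀ i : Fin k, x i.castSucc ≠ x i.succ) ∧ length G x = l}

variable {G}

theorem length_succ {k : ℕ} (x : Fin (k + 2) → V) :
    length G x = G.edist (x 0) (x 1) + length G (fun i => x i.succ) := by
  simp only [length, Fin.sum_univ_succ (n := k)]
  rfl

theorem length_face_zero {k : ℕ} (x : Fin (k + 2) → V) :
    length G (fun i => x ((0 : Fin (k + 2)).succAbove i)) = length G (fun i => x i.succ) := by
  simp

theorem length_face_succ {k : ℕ} (x : Fin (k + 3) → V) (j : Fin (k + 2)) :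
    length G (fun i => x (j.succ.succAbove i)) =
      G.edist (x 0) (x (j.succAbove 0).succ) +
        length G (fun i => x (j.succAbove i).succ) := by
  rw [length_succ]
  have h : (1 : Fin (k + 2)) = Fin.succ 0 := rfl
  simp only [Fin.succ_succAbove_succ, Fin.succ_succAbove_zero, h]

/-- Omitting a vertex does not increase the length. -/
theorem length_face_le {k : ℕ} (x : Fin (k + 2) → V) (j : Fin (k + 2)) :
    length G (fun i => x (j.succAbove i)) ≤ length G x := by
  induction k with
  | zero => simp [length]
  | succ k ih =>
    rw [length_succ x]
    refine Fin.cases ?_ (fun j => ?_) j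
    · rw [length_face_zero]
      exact le_add_self
    · rw [length_face_succ]
      by_cases hj : j = 0
      · subst hj
        rw [length_succ (fun i => x i.succ), ← add_assoc]
        simp only [Fin.zero_succAbove]
        gcongr
        exact G.edist_triangle
      · have h0 : j.succAbove 0 = 0 := Fin.succAbove_ne_zero_zero hj
        rw [h0]
        gcongr
        · rfl
        · exact ih (fun i => x i.succ) j

/-- If omitting a vertex preserves a finite length, then consecutive vertices stay distinct. -/
theorem ne_of_length_face_eq {k : ℕ} (x : Fin (k + 2) → V)
    (hx : ∀ i : Fin (k + 1), x i.castSucc ≠ x i.succ) (j : Fin (k + 2))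
    (hfin : length G x ≠ ⊤) (h : length G (fun i => x (j.succAbove i)) = length G x)
    (i : Fin k) : x (j.succAbove i.castSucc) ≠ x (j.succAbove i.succ) := by
  induction k with
  | zero => exact i.elim0
  | succ k ih =>
    have hl := length_succ (G := G) x
    have htail : length G (fun i => x i.succ) ≠ ⊤ := by
      intro ht; rw [ht] at hl; exact hfin (by simpa using hl)
    have hhead : G.edist (x 0) (x 1) ≠ ⊤ := by
      intro ht; rw [ht] at hl; exact hfin (by simpa using hl)
    revert h
    refine Fin.cases ?_ (fun j => ?_) j
    · intro _
      simpa using hx i.succ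
    · intro h
      rw [length_face_succ, hl] at h
      by_cases hj : j = 0
      · subst hj
        simp only [Fin.zero_succAbove] at h
        refine Fin.cases ?_ (fun i => ?_) i
        · simp only [Fin.castSucc_zero, Fin.succ_succAbove_zero, Fin.succ_succAbove_succ,
            Fin.zero_succAbove]
          intro h02
          rw [h02, SimpleGraph.edist_self, zero_add, length_succ (fun i => x i.succ)] at h
          rw [length_succ (fun i => x i.succ)] at htail
          have hne : G.edist (x 0) (x 1) ≠ 0 := by
            rw [Ne, SimpleGraph.edist_eq_zero_iff]; exact hx 0
          have hA : length G (fun i : Fin (k + 1) => x i.succ.succ) ≠ ⊤ := by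
            intro ht; exact htail (by rw [ht]; simp)
          have h1 : G.edist (x 0) (x 1) + length G (fun i : Fin (k + 1) => x i.succ.succ) ≤
              0 + length G (fun i : Fin (k + 1) => x i.succ.succ) := by
            rw [zero_add]
            refine le_trans ?_ h.ge
            rw [h02]
            gcongr
            exact le_add_self
          exact hne (le_antisymm ((ENat.add_le_add_iff_right hA).mp h1) bot_le)
        · simpa using hx i.succ.succ
      · have h0 : j.succAbove 0 = 0 := Fin.succAbove_ne_zero_zero hj
        rw [h0] at h
        have h' := WithTop.add_left_cancel hhead h
        refine Fin.cases ?_ (fun i => ?_) i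
        · simp only [Fin.castSucc_zero, Fin.succ_succAbove_zero, Fin.succ_succAbove_succ, h0]
          exact hx 0
        · have := ih (fun i => x i.succ) (fun i => hx i.succ) j htail h' i
          simpa [Fin.succ_succAbove_succ, ← Fin.succ_castSucc] using this

/-- The sequence obtained from `x` by omitting `x_i`, when this has the same length. -/
def Gen.face {k l : ℕ} (x : Gen G (k + 1) l) (i : Fin (k + 2))
    (h : length G (fun j => x.1 (i.succAbove j)) = l) : Gen G k l :=
  ⟨fun j => x.1 (i.succAbove j),
    ne_of_length_face_eq x.1 x.2.1 i (by rw [x.2.2]; exact ENat.natCast_ne_top l)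
      (h.trans x.2.2.symm), h⟩

variable (G)

open Classical in
/-- The map `∂_i` of the magnitude chain complex, which sends a generator to the sequence with
`x_i` omitted if this has the same length and to `0` otherwise. -/
noncomputable def faceMap (k l : ℕ) (i : Fin (k + 2)) :
    (Gen G (k + 1) l →₀ ℤ) →ₗ[ℤ] (Gen G k l →₀ ℤ) :=
  Finsupp.linearCombination ℤ fun x =>
    if h : length G (fun j => x.1 (i.succAbove j)) = l then Finsupp.single (x.face i h) 1 else 0

/-- The differential `MC_{k+1,l}(G) → MC_{k,l}(G)`: the sum of `(-1)^i ∂_i` over `0 < i < k + 1`. -/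
noncomputable def boundary (k l : ℕ) : (Gen G (k + 1) l →₀ ℤ) →ₗ[ℤ] (Gen G k l →₀ ℤ) :=
  ∑ i ∈ Finset.Ioo (0 : Fin (k + 2)) (Fin.last (k + 1)), (-1 : ℤ) ^ (i : ℕ) • faceMap G k l i

open Classical in
/-- Omitting two vertices in succession gives the doubly reduced sequence if it has length `l`, and
`0` otherwise. -/
theorem faceMap_faceMap_single (k l : ℕ) (x : Gen G (k + 2) l) (j : Fin (k + 3))
    (i : Fin (k + 2)) :
    faceMap G k l i (faceMap G (k + 1) l j (Finsupp.single x 1)) =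
      if h : ∃ y : Gen G k l, y.1 = fun m => x.1 (j.succAbove (i.succAbove m))
      then Finsupp.single h.choose 1 else 0 := by
  have hle1 := length_face_le (G := G) x.1 j
  have hle2 := length_face_le (G := G) (fun m => x.1 (j.succAbove m)) i
  rw [x.2.2] at hle1
  simp only [faceMap, Finsupp.linearCombination_single, one_smul]
  by_cases h1 : length G (fun m => x.1 (j.succAbove m)) = l
  · rw [dif_pos h1, Finsupp.linearCombination_single, one_smul]
    by_cases h2 : length G (fun m => x.1 (j.succAbove (i.succAbove m))) = l
    · have hex : ∃ y : Gen G k l, y.1 = fun m => x.1 (j.succAbove (i.succAbove m)) :=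
        ⟨(x.face j h1).face i h2, rfl⟩
      rw [dif_pos hex, dif_pos (show length G (fun m => (x.face j h1).1 (i.succAbove m)) = l
        from h2)]
      congr 1
      exact Subtype.ext hex.choose_spec.symm
    · rw [dif_neg (show ¬ length G (fun m => (x.face j h1).1 (i.succAbove m)) = l from h2),
        dif_neg]
      rintro ⟨y, hy⟩
      exact h2 (by rw [← hy]; exact y.2.2)
  · rw [dif_neg h1, map_zero, dif_neg]
    rintro ⟨y, hy⟩
    rw [← hy, y.2.2] at hle2
    exact h1 (le_antisymm hle1 hle2)

/-- The simplicial identity for the maps `∂_i`. -/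
theorem faceMap_comp_faceMap (k l : ℕ) (i j : Fin (k + 2)) (hij : i ≤ j) :
    faceMap G k l i ∘ₗ faceMap G (k + 1) l j.succ =
      faceMap G k l j ∘ₗ faceMap G (k + 1) l i.castSucc := by
  refine Finsupp.lhom_ext' fun x => LinearMap.ext_ring ?_
  simp only [LinearMap.comp_apply, Finsupp.lsingle_apply]
  rw [faceMap_faceMap_single, faceMap_faceMap_single]
  have h : (fun m => x.1 (j.succ.succAbove (i.succAbove m))) =
      fun m => x.1 (i.castSucc.succAbove (j.succAbove m)) := by
    funext m
    refine congrArg x.1 (Fin.ext ?_)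
    simp only [Fin.succAbove, Fin.lt_def, Fin.le_def] at *
    split_ifs <;> simp_all <;> omega
  rw [h]

/-- The differential squares to zero. -/
theorem boundary_comp_boundary (k l : ℕ) : boundary G k l ∘ₗ boundary G (k + 1) l = 0 := by
  have e : boundary G k l ∘ₗ boundary G (k + 1) l =
      ∑ i ∈ Finset.Ioo (0 : Fin (k + 2)) (Fin.last (k + 1)),
        ∑ j ∈ Finset.Ioo (0 : Fin (k + 3)) (Fin.last (k + 2)),
          ((-1 : ℤ) ^ (i : ℕ) * (-1 : ℤ) ^ (j : ℕ)) •
            (faceMap G k l i ∘ₗ faceMap G (k + 1) l j) := by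
    refine LinearMap.ext fun v => ?_
    simp only [boundary, LinearMap.comp_apply, LinearMap.sum_apply, LinearMap.smul_apply, map_sum,
      map_zsmul, Finset.smul_sum, smul_smul]
    rw [Finset.sum_comm]
    simp only [mul_comm]
  rw [e, ← Finset.sum_product',
    ← Finset.sum_filter_add_sum_filter_not _ (fun ij => (ij.2 : ℕ) ≤ (ij.1 : ℕ)),
    ← eq_neg_iff_add_eq_zero, ← Finset.sum_neg_distrib]
  refine Finset.sum_bij
    (fun ij hij => (Fin.castLT ij.2 (lt_of_le_of_lt (Finset.mem_filter.mp hij).2 ij.1.isLt),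
      ij.1.succ)) ?_ ?_ ?_ ?_
  · rintro ⟨i, j⟩ hij
    simp only [Finset.mem_filter, Finset.mem_product, Finset.mem_Ioo, Fin.lt_def, Fin.val_zero,
      Fin.val_last, Fin.val_succ, Fin.val_castLT] at hij ⊢
    omega
  · rintro ⟨i, j⟩ hij ⟨i', j'⟩ hij' h
    simp only [Prod.mk.injEq, Fin.ext_iff, Fin.val_succ, Fin.val_castLT] at h ⊢
    omega
  · rintro ⟨i, j⟩ hij
    simp only [Finset.mem_filter, Finset.mem_product, Finset.mem_Ioo, Fin.lt_def, Fin.val_zero,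
      Fin.val_last] at hij
    refine ⟨(⟨(j : ℕ) - 1, by omega⟩, i.castSucc), ?_, ?_⟩
    · simp only [Finset.mem_filter, Finset.mem_product, Finset.mem_Ioo, Fin.lt_def, Fin.val_zero,
        Fin.val_last, Fin.val_castSucc]
      obtain ⟨⟨⟨h1, h2⟩, h3, h4⟩, h5⟩ := hij
      exact ⟨⟨⟨by omega, by omega⟩, by omega, by omega⟩, by omega⟩
    · simp only [Prod.mk.injEq, Fin.ext_iff, Fin.val_succ, Fin.val_castLT, Fin.val_castSucc]
      exact ⟨trivial, by omega⟩
  · rintro ⟨i, j⟩ hij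
    have hlt : (j : ℕ) < k + 2 := lt_of_le_of_lt (Finset.mem_filter.mp hij).2 i.isLt
    have hc := faceMap_comp_faceMap G k l (Fin.castLT j hlt) i (Finset.mem_filter.mp hij).2
    rw [Fin.castSucc_castLT] at hc
    simp only [Fin.val_succ, Fin.val_castLT]
    rw [hc, ← neg_smul]
    congr 1
    ring

/-- The magnitude chain complex `MC_{*,l}(G)`. -/
noncomputable def magnitudeComplex (l : ℕ) : ChainComplex (ModuleCat.{u} ℤ) ℕ :=
  ChainComplex.of (fun k => ModuleCat.of ℤ (Gen G k l →₀ ℤ))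
    (fun k => ModuleCat.ofHom (boundary G k l))
    (fun k => by
      rw [← ModuleCat.ofHom_comp, boundary_comp_boundary]
      rfl)

/-- The magnitude homology group `MH_{k,l}(G) = H_k(MC_{*,l}(G))`. -/
noncomputable def magnitudeHomology (k l : ℕ) : ModuleCat.{u} ℤ :=
  (magnitudeComplex G l).homology k

end Homology

/-- The `4 × 4` rook graph: the Cayley graph on `ℤ/4 × ℤ/4` with generators `(0, x)` and `(x, 0)`
for `x = 1, 2, 3`. -/
def rookGraph : SimpleGraph (ZMod 4 × ZMod 4) :=
  SimpleGraph.addCayley {(0, 1), (0, 2), (0, 3), (1, 0), (2, 0), (3, 0)}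

/-- The Shrikhande graph: the Cayley graph on `ℤ/4 × ℤ/4` with generators `±(0, 1)`, `±(1, 0)` and
`±(1, 1)`. -/
def shrikhandeGraph : SimpleGraph (ZMod 4 × ZMod 4) :=
  SimpleGraph.addCayley {(0, 1), -(0, 1), (1, 0), -(1, 0), (1, 1), -(1, 1)}

end GraphMagnitude

namespace GraphMagnitude

universe u

/-! ### Criteria for homology to vanish or to have positive rank -/

section HomologyCriteria

open CategoryTheory

variable {V : Type u} (G : SimpleGraph V)

/-! In both graphs every vertex has 6 neighbours and 9 vertices at distance two, so every row of the
similarity matrix sums to `1 + 6q + 9q²`. The inverse matrix applied to the all-ones vector is then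
constant, which determines the magnitude (`magnitudeAt_mul`).

For the rook graph, distance is the number of coordinates that differ. A generator of `MC_{3,4}` has
two unit steps and one diagonal step. Routing diagonal steps through a corner gives walks of four
unit steps, and the boundaries of these walks are relations in the cokernel of `MC_{4,4} →
MC_{3,4}`. Solving the relations shows that the class of a generator is a function of its boundary
(`IsRookCocycle.eq_sub`). Thus the projection to the cokernel factors through the differential to
`MC_{2,4}`, and every cycle is a boundary.

For the Shrikhande graph, an explicit integral cocycle (`shrikhandeCocycle`) takes a nonzero value
on a single generator that is already a cycle. This pairing forces a homology class of infinite
order (`rank_magnitudeHomology_ne_zero`), and the two homology groups in degree `(3, 4)` differ. -/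

theorem magnitudeComplex_d (k l : ℕ) :
    (magnitudeComplex G l).d (k + 1) k = ModuleCat.ofHom (boundary G k l) := by
  simp [magnitudeComplex]

theorem isZero_magnitudeHomology (k l : ℕ)
    (h : ∀ z, boundary G k l z = 0 → ∃ b, boundary G (k + 1) l b = z) :
    Limits.IsZero (magnitudeHomology G (k + 1) l) := by
  rw [magnitudeHomology, ← HomologicalComplex.exactAt_iff_isZero_homology,
    HomologicalComplex.exactAt_iff' _ (k + 2) (k + 1) k (by simp) (by simp),
    ShortComplex.moduleCat_exact_iff]
  intro z hz
  obtain ⟨b, hb⟩ := h z (by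
    have := hz
    simp only [HomologicalComplex.shortComplexFunctor'_obj_g, magnitudeComplex_d] at this
    exact this)
  refine ⟨b, ?_⟩
  simp only [HomologicalComplex.shortComplexFunctor'_obj_f, magnitudeComplex_d]
  exact hb

/-- A cocycle that does not vanish on a cycle detects a free part of the homology. -/
theorem rank_magnitudeHomology_ne_zero {V : Type} (G : SimpleGraph V) (k l : ℕ)
    (φ : (Gen G (k + 1) l →₀ ℤ) →ₗ[ℤ] ℤ) (hφ : φ ∘ₗ boundary G (k + 1) l = 0)
    (z : Gen G (k + 1) l →₀ ℤ) (hz : boundary G k l z = 0) (hφz : φ z ≠ 0) :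
    Module.rank ℤ (magnitudeHomology G (k + 1) l) ≠ 0 := by
  let K := magnitudeComplex G l
  let ζ : ModuleCat.of ℤ ℤ ⟶ K.X (k + 1) :=
    ModuleCat.ofHom (LinearMap.toSpanSingleton ℤ (Gen G (k + 1) l →₀ ℤ) z)
  let ψ : K.X (k + 1) ⟶ ModuleCat.of ℤ ℤ := ModuleCat.ofHom φ
  have hζ : ζ ≫ K.d (k + 1) k = 0 := by
    rw [magnitudeComplex_d]
    exact ModuleCat.hom_ext (LinearMap.ext_ring
      ((congrArg (boundary G k l) (one_smul ℤ z)).trans hz))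
  have hψ : K.d (k + 2) (k + 1) ≫ ψ = 0 := by
    rw [magnitudeComplex_d]
    exact ModuleCat.hom_ext hφ
  -- The cycle gives a map from `ℤ` to the homology and the cocycle a map from the homology to `ℤ`.
  -- Their composite sends `1` to `φ z ≠ 0`, so the class of `z` is not torsion.
  let c := K.liftCycles ζ k (by simp) hζ ≫ K.homologyπ (k + 1)
  let e := K.homologyι (k + 1) ≫ K.descOpcycles ψ (k + 2) (by simp) hψ
  have hce : c ≫ e = ζ ≫ ψ := by simp [c, e]
  have hce1 : e.hom (c.hom (1 : ℤ)) = φ z :=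
    (congrArg (fun f => f.hom (1 : ℤ)) hce).trans (congrArg φ (one_smul ℤ z))
  intro h0
  obtain ⟨a, ha, ha0⟩ := rank_eq_zero_iff.mp h0 (c.hom (1 : ℤ))
  have h1 : a • φ z = 0 := by
    rw [← hce1]
    exact (e.hom.map_smul a _).symm.trans ((congrArg e.hom ha0).trans (map_zero e.hom))
  exact mul_ne_zero ha hφz h1

end HomologyCriteria

/-! ### Chains given by vertex sequences, and explicit low-degree boundaries -/

section Chains

variable {V : Type u} (G : SimpleGraph V)

open Classical in
/-- The generator of `MC_{k,l}(G)` given by a sequence of vertices, or `0` if the sequence is not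
admissible. -/
noncomputable def chainOf (k l : ℕ) (x : Fin (k + 1) → V) : Gen G k l →₀ ℤ :=
  if h : (∀ i : Fin k, x i.castSucc ≠ x i.succ) ∧ length G x = l then
    Finsupp.single ⟨x, h⟩ 1 else 0

variable {G}

theorem chainOf_val {k l : ℕ} (x : Gen G k l) : chainOf G k l x.1 = Finsupp.single x 1 :=
  dif_pos x.2

theorem linearCombination_chainOf {A : Type*} [AddCommGroup A] {k l : ℕ} (f : Gen G k l → A)
    {x : Fin (k + 1) → V} (hx : (∀ i : Fin k, x i.castSucc ≠ x i.succ) ∧ length G x = l) :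
    Finsupp.linearCombination ℤ f (chainOf G k l x) = f ⟨x, hx⟩ := by
  let g : Gen G k l := ⟨x, hx⟩
  rw [show chainOf G k l x = Finsupp.single g 1 from chainOf_val g,
    Finsupp.linearCombination_single, one_smul]

/-- A face of unchanged length automatically has distinct consecutive vertices, so the default value
`0` of `chainOf` occurs exactly when `∂_i` is zero. Faces can then be written without a length test.
-/
theorem faceMap_single {k l : ℕ} (x : Gen G (k + 1) l) (i : Fin (k + 2)) :
    faceMap G k l i (Finsupp.single x 1) = chainOf G k l fun j => x.1 (i.succAbove j) := by
  rw [faceMap, Finsupp.linearCombination_single, one_smul, chainOf]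
  by_cases h : length G (fun j => x.1 (i.succAbove j)) = l
  · rw [dif_pos h, dif_pos ⟨(x.face i h).2.1, h⟩]
    rfl
  · rw [dif_neg h, dif_neg fun h' => h h'.2]

theorem boundary_single {k l : ℕ} (x : Gen G (k + 1) l) :
    boundary G k l (Finsupp.single x 1) =
      ∑ i ∈ Finset.Ioo (0 : Fin (k + 2)) (Fin.last (k + 1)),
        (-1 : ℤ) ^ (i : ℕ) • chainOf G k l fun j => x.1 (i.succAbove j) := by
  simp only [boundary, LinearMap.sum_apply, LinearMap.smul_apply, faceMap_single]

theorem boundary_chainOf_three {l : ℕ} {x : Fin 4 → V}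
    (hx : ∀ i : Fin 3, x i.castSucc ≠ x i.succ) (hl : length G x = l) :
    boundary G 2 l (chainOf G 3 l x) =
      chainOf G 2 l ![x 0, x 1, x 3] - chainOf G 2 l ![x 0, x 2, x 3] := by
  have e : Finset.Ioo (0 : Fin 4) (Fin.last 3) = {1, 2} := by decide
  let g : Gen G 3 l := ⟨x, hx, hl⟩
  rw [show chainOf G 3 l x = Finsupp.single g 1 from chainOf_val g, boundary_single, e,
    Finset.sum_pair (by decide)]
  have h1 : (fun j => x ((1 : Fin 4).succAbove j)) = ![x 0, x 2, x 3] := by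
    ext j; fin_cases j <;> rfl
  have h2 : (fun j => x ((2 : Fin 4).succAbove j)) = ![x 0, x 1, x 3] := by
    ext j; fin_cases j <;> rfl
  simp only [g, h1, h2]
  simp
  abel

theorem boundary_chainOf_four {l : ℕ} {x : Fin 5 → V}
    (hx : ∀ i : Fin 4, x i.castSucc ≠ x i.succ) (hl : length G x = l) :
    boundary G 3 l (chainOf G 4 l x) =
      -chainOf G 3 l ![x 0, x 2, x 3, x 4] + chainOf G 3 l ![x 0, x 1, x 3, x 4] -
        chainOf G 3 l ![x 0, x 1, x 2, x 4] := by
  have e : Finset.Ioo (0 : Fin 5) (Fin.last 4) = {1, 2, 3} := by decide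
  let g : Gen G 4 l := ⟨x, hx, hl⟩
  rw [show chainOf G 4 l x = Finsupp.single g 1 from chainOf_val g, boundary_single, e,
    Finset.sum_insert (by decide),
    Finset.sum_pair (by decide)]
  have h1 : (fun j => x ((1 : Fin 5).succAbove j)) = ![x 0, x 2, x 3, x 4] := by
    ext j; fin_cases j <;> rfl
  have h2 : (fun j => x ((2 : Fin 5).succAbove j)) = ![x 0, x 1, x 3, x 4] := by
    ext j; fin_cases j <;> rfl
  have h3 : (fun j => x ((3 : Fin 5).succAbove j)) = ![x 0, x 1, x 2, x 4] := by
    ext j; fin_cases j <;> rfl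
  simp only [g, h1, h2, h3]
  simp [pow_succ]
  abel

theorem gen_eq_vec_four {l : ℕ} (x : Gen G 4 l) :
    x.1 = ![x.1 0, x.1 1, x.1 2, x.1 3, x.1 4] := by
  ext j; fin_cases j <;> rfl

theorem gen_eq_vec_three {l : ℕ} (x : Gen G 3 l) : x.1 = ![x.1 0, x.1 1, x.1 2, x.1 3] := by
  ext j; fin_cases j <;> rfl

theorem length_vec_two {δ : V → V → ℕ} (h : ∀ x y, G.edist x y = δ x y) (x y z : V) :
    length G ![x, y, z] = ((δ x y + δ y z : ℕ) : ℕ∞) := by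
  simp [length, Fin.sum_univ_succ, h]

theorem length_vec_three {δ : V → V → ℕ} (h : ∀ x y, G.edist x y = δ x y) (x y z w : V) :
    length G ![x, y, z, w] = ((δ x y + δ y z + δ z w : ℕ) : ℕ∞) := by
  simp [length, Fin.sum_univ_succ, h, add_assoc]

theorem length_vec_four {δ : V → V → ℕ} (h : ∀ x y, G.edist x y = δ x y) (x y z w v : V) :
    length G ![x, y, z, w, v] = ((δ x y + δ y z + δ z w + δ w v : ℕ) : ℕ∞) := by
  simp [length, Fin.sum_univ_succ, h, add_assoc]

end Chains

/-! ### Distance in graphs of diameter at most two -/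

section Distance

variable {V : Type u} [DecidableEq V] (G : SimpleGraph V) [DecidableRel G.Adj]

/-- The distance function of a graph of diameter at most two. -/
def shortDist (x y : V) : ℕ :=
  if x = y then 0 else if G.Adj x y then 1 else 2

variable {G}

theorem edist_eq_shortDist (hG : ∀ x y, x ≠ y → ¬ G.Adj x y → ∃ z, G.Adj x z ∧ G.Adj z y)
    (x y : V) : G.edist x y = shortDist G x y := by
  unfold shortDist
  split_ifs with h1 h2
  · simp [h1]
  · simpa using h2
  · obtain ⟨z, hz⟩ := hG x y h1 h2
    have := SimpleGraph.edist_eq_two_iff (G := G) (u := x) (v := y)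
    rw [Nat.cast_ofNat, this]
    exact ⟨h1, h2, z, hz.1, hz.2.symm⟩

end Distance

/-! ### Magnitude from constant row sums -/

section Magnitude

variable {V : Type u} [Fintype V] [DecidableEq V] (G : SimpleGraph V)

/-- If the rows of the similarity matrix have constant sum `c`, then the magnitude times `c` is the
number of vertices. -/
theorem magnitudeAt_mul {R : Type*} [CommRing R] (q c : R)
    (hdet : IsUnit (similarityMatrix G q).det) (hrow : ∀ x, ∑ y, similarityMatrix G q x y = c) :
    magnitudeAt G q * c = Fintype.card V := by
  have h : (similarityMatrix G q).mulVec (fun _ => 1) = fun _ => c := by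
    ext x
    simpa [Matrix.mulVec, dotProduct] using hrow x
  have h2 := congrArg ((similarityMatrix G q)⁻¹.mulVec) h
  rw [Matrix.mulVec_mulVec, Matrix.nonsing_inv_mul _ hdet, Matrix.one_mulVec] at h2
  have h3 : ∀ x, ∑ y, (similarityMatrix G q)⁻¹ x y * c = 1 := fun x => (congrFun h2 x).symm
  simp only [magnitudeAt, Finset.sum_mul, h3]
  simp

variable [DecidableRel G.Adj]

theorem sum_similarityMatrix {R : Type*} [CommRing R] (q : R)
    (hG : ∀ x y, x ≠ y → ¬ G.Adj x y → ∃ z, G.Adj x z ∧ G.Adj z y) (x : V) :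
    ∑ y, similarityMatrix G q x y =
      1 + (Finset.univ.filter fun y => shortDist G x y = 1).card * q +
        (Finset.univ.filter fun y => shortDist G x y = 2).card * q ^ 2 := by
  have h : ∀ y, similarityMatrix G q x y = (if x = y then 1 else 0) +
      (if shortDist G x y = 1 then q else 0) + (if shortDist G x y = 2 then q ^ 2 else 0) := by
    intro y
    have he := edist_eq_shortDist hG x y
    have hr : G.Reachable x y := SimpleGraph.reachable_of_edist_ne_top (by rw [he]; simp)
    rw [similarityMatrix, Matrix.of_apply, if_pos hr, SimpleGraph.dist, he, ENat.toNat_natCast]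
    unfold shortDist
    split_ifs <;> simp_all
  simp only [h, Finset.sum_add_distrib, Finset.sum_ite_eq, Finset.mem_univ, if_true,
    Finset.sum_ite, Finset.sum_const, nsmul_eq_mul, mul_zero, add_zero]

end Magnitude

/-! ### The magnitudes of the two graphs -/

section Magnitudes

/-- Quantifying over a `Finset` of generators makes adjacency computable, so that the statements
about all vertices can be checked by `decide`. -/
instance : DecidableRel rookGraph.Adj := fun x y =>
  decidable_of_iff (x ≠ y ∧ ∃ g ∈ ({(0, 1), (0, 2), (0, 3), (1, 0), (2, 0), (3, 0)} :
    Finset (ZMod 4 × ZMod 4)), x + g = y ∨ x = y + g) (by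
    rw [rookGraph, SimpleGraph.addCayley_adj']; simp)

instance : DecidableRel shrikhandeGraph.Adj := fun x y =>
  decidable_of_iff (x ≠ y ∧ ∃ g ∈ ({(0, 1), -(0, 1), (1, 0), -(1, 0), (1, 1), -(1, 1)} :
    Finset (ZMod 4 × ZMod 4)), x + g = y ∨ x = y + g) (by
    rw [shrikhandeGraph, SimpleGraph.addCayley_adj']; simp)

theorem rookGraph_diam (x y : ZMod 4 × ZMod 4) :
    x ≠ y → ¬ rookGraph.Adj x y → ∃ z, rookGraph.Adj x z ∧ rookGraph.Adj z y := by
  revert x y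
  decide +kernel

theorem shrikhandeGraph_diam (x y : ZMod 4 × ZMod 4) :
    x ≠ y → ¬ shrikhandeGraph.Adj x y →
      ∃ z, shrikhandeGraph.Adj x z ∧ shrikhandeGraph.Adj z y := by
  revert x y
  decide +kernel

theorem rookGraph_card_sphere (x : ZMod 4 × ZMod 4) :
    (Finset.univ.filter fun y => shortDist rookGraph x y = 1).card = 6 ∧
      (Finset.univ.filter fun y => shortDist rookGraph x y = 2).card = 9 := by
  revert x
  decide +kernel

theorem shrikhandeGraph_card_sphere (x : ZMod 4 × ZMod 4) :
    (Finset.univ.filter fun y => shortDist shrikhandeGraph x y = 1).card = 6 ∧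
      (Finset.univ.filter fun y => shortDist shrikhandeGraph x y = 2).card = 9 := by
  revert x
  decide +kernel

theorem magnitudeAt_rookGraph_mul {R : Type*} [CommRing R] (q : R)
    (hdet : IsUnit (similarityMatrix rookGraph q).det) :
    magnitudeAt rookGraph q * (1 + 6 * q + 9 * q ^ 2) = 16 := by
  rw [magnitudeAt_mul rookGraph q _ hdet fun x => ?_]
  · simp [ZMod.card]
  · rw [sum_similarityMatrix rookGraph q rookGraph_diam, (rookGraph_card_sphere x).1,
      (rookGraph_card_sphere x).2]
    norm_num

theorem magnitudeAt_shrikhandeGraph_mul {R : Type*} [CommRing R] (q : R)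
    (hdet : IsUnit (similarityMatrix shrikhandeGraph q).det) :
    magnitudeAt shrikhandeGraph q * (1 + 6 * q + 9 * q ^ 2) = 16 := by
  rw [magnitudeAt_mul shrikhandeGraph q _ hdet fun x => ?_]
  · simp [ZMod.card]
  · rw [sum_similarityMatrix shrikhandeGraph q shrikhandeGraph_diam,
      (shrikhandeGraph_card_sphere x).1, (shrikhandeGraph_card_sphere x).2]
    norm_num

theorem ratFunc_denominator_ne_zero : (1 + 6 * RatFunc.X + 9 * RatFunc.X ^ 2 : RatFunc ℚ) ≠ 0 := by
  have h : (1 + 6 * RatFunc.X + 9 * RatFunc.X ^ 2 : RatFunc ℚ) =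
      algebraMap (Polynomial ℚ) (RatFunc ℚ) (1 + 6 * Polynomial.X + 9 * Polynomial.X ^ 2) := by
    simp only [map_add, map_mul, map_pow, map_one, map_ofNat, RatFunc.algebraMap_X]
  rw [h, Ne, map_eq_zero_iff _ (RatFunc.algebraMap_injective ℚ)]
  intro h0
  have := congrArg (Polynomial.eval 0) h0
  simp at this

theorem powerSeries_denominator_ne_zero :
    (1 + 6 * PowerSeries.X + 9 * PowerSeries.X ^ 2 : PowerSeries ℤ) ≠ 0 := by
  intro h0
  have := congrArg (PowerSeries.constantCoeff (R := ℤ)) h0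
  simp at this

end Magnitudes

/-! ### Solving the cocycle relations on a rectangular board -/

section RookHomology

variable {α β A : Type*} [DecidableEq α] [DecidableEq β] [AddCommGroup A]

/-- The distance of two cells of a rectangular board under rook moves. -/
def rookDist (x y : α × β) : ℕ :=
  (if x.1 = y.1 then 0 else 1) + if x.2 = y.2 then 0 else 1

theorem shortDist_rookGraph (x y : ZMod 4 × ZMod 4) : shortDist rookGraph x y = rookDist x y := by
  revert x y
  decide +kernel

variable {s : α × β → α × β → α × β → α × β → A}

/-- A function on quadruples of cells that is supported in length four and vanishes on the
boundaries of the walks of length four. -/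
structure IsRookCocycle (s : α × β → α × β → α × β → α × β → A) : Prop where
  zero : ∀ x y z w, rookDist x y + rookDist y z + rookDist z w ≠ 4 → s x y z w = 0
  rel : ∀ x y z w v, rookDist x y = 1 → rookDist y z = 1 → rookDist z w = 1 →
    rookDist w v = 1 → s x z w v - s x y w v + s x y z v = 0

/- The names of the next lemmas list the kinds of the three steps of the quadruple: `v` changes the
second coordinate, `h` the first one, and `d` both. -/

/-- The diagonal step is routed through a corner and `rel` is applied to the resulting walk of unit
steps. Omitting the vertex between two parallel steps makes the quadruple too short, so that term
vanishes. The lemmas below use the same device, with walks chosen so that each remaining term is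
short, already known, or the one sought. -/
theorem IsRookCocycle.vdh (hs : IsRookCocycle s) {a c d : α} {b b' c' : β}
    (h1 : b ≠ b') (h2 : a ≠ c) (h3 : b' ≠ c') (h4 : c ≠ d) :
    s (a, b) (a, b') (c, c') (d, c') = 0 := by
  have h := hs.rel (a, b) (a, b') (a, c') (c, c') (d, c') (by grind [rookDist]) (by grind [rookDist])
    (by grind [rookDist]) (by grind [rookDist])
  rw [hs.zero (a, b) (a, c') (c, c') (d, c') (by grind [rookDist]),
    hs.zero (a, b) (a, b') (a, c') (d, c') (by grind [rookDist])] at h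
  grind

theorem IsRookCocycle.vvd (hs : IsRookCocycle s) {a c : α} {b b' b'' e : β}
    (h1 : b ≠ b') (h2 : b' ≠ b'') (h3 : a ≠ c) (h4 : b'' ≠ e) :
    s (a, b) (a, b') (a, b'') (c, e) = 0 := by
  have h := hs.rel (a, b) (a, b') (a, b'') (a, e) (c, e) (by grind [rookDist]) (by grind [rookDist])
    (by grind [rookDist]) (by grind [rookDist])
  rw [hs.zero (a, b) (a, b'') (a, e) (c, e) (by grind [rookDist]),
    hs.zero (a, b) (a, b') (a, e) (c, e) (by grind [rookDist])] at h
  grind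

theorem IsRookCocycle.vdv (hs : IsRookCocycle s) {a c : α} {b b' e f : β}
    (h1 : b ≠ b') (h2 : a ≠ c) (h3 : b' ≠ e) (h4 : e ≠ f) :
    s (a, b) (a, b') (c, e) (c, f) = 0 := by
  have h := hs.rel (a, b) (a, b') (a, e) (c, e) (c, f) (by grind [rookDist]) (by grind [rookDist])
    (by grind [rookDist]) (by grind [rookDist])
  rw [hs.zero (a, b) (a, e) (c, e) (c, f) (by grind [rookDist]),
    hs.vvd h1 h3 h2 h4] at h
  grind

theorem IsRookCocycle.dhh (hs : IsRookCocycle s) {a c d f : α} {b e : β}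
    (h1 : a ≠ c) (h2 : b ≠ e) (h3 : c ≠ d) (h4 : d ≠ f) :
    s (a, b) (c, e) (d, e) (f, e) = 0 := by
  have h := hs.rel (a, b) (a, e) (c, e) (d, e) (f, e) (by grind [rookDist]) (by grind [rookDist])
    (by grind [rookDist]) (by grind [rookDist])
  rw [hs.zero (a, b) (a, e) (d, e) (f, e) (by grind [rookDist]),
    hs.zero (a, b) (a, e) (c, e) (f, e) (by grind [rookDist])] at h
  grind

theorem IsRookCocycle.hdh (hs : IsRookCocycle s) {a c d f : α} {b e : β}
    (h1 : a ≠ c) (h2 : c ≠ d) (h3 : b ≠ e) (h4 : d ≠ f) :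
    s (a, b) (c, b) (d, e) (f, e) = 0 := by
  have h := hs.rel (a, b) (c, b) (c, e) (d, e) (f, e) (by grind [rookDist]) (by grind [rookDist])
    (by grind [rookDist]) (by grind [rookDist])
  rw [hs.zero (a, b) (c, b) (c, e) (f, e) (by grind [rookDist]),
    hs.dhh h1 h3 h2 h4] at h
  grind

/-- The value at kind `vhd` is not constrained to vanish. It serves as the free parameter in terms
of which `dhv`, `dvh` and `hvd` are expressed. -/
theorem IsRookCocycle.dhv (hs : IsRookCocycle s) {a c d : α} {b e f : β}
    (h1 : a ≠ c) (h2 : b ≠ e) (h3 : c ≠ d) (h4 : e ≠ f) :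
    s (a, b) (c, e) (d, e) (d, f) = -s (a, b) (a, e) (c, e) (d, f) := by
  have h := hs.rel (a, b) (a, e) (c, e) (d, e) (d, f) (by grind [rookDist]) (by grind [rookDist])
    (by grind [rookDist]) (by grind [rookDist])
  rw [hs.zero (a, b) (a, e) (d, e) (d, f) (by grind [rookDist])] at h
  grind

theorem IsRookCocycle.dvh (hs : IsRookCocycle s) {a c d : α} {b e f : β}
    (h1 : a ≠ c) (h2 : b ≠ e) (h3 : c ≠ d) (h4 : e ≠ f) :
    s (a, b) (c, e) (c, f) (d, f) = -s (a, b) (a, e) (c, e) (d, f) := by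
  have h := hs.rel (a, b) (a, e) (c, e) (c, f) (d, f) (by grind [rookDist]) (by grind [rookDist])
    (by grind [rookDist]) (by grind [rookDist])
  rw [hs.vdh h2 h1 h4 h3] at h
  grind

theorem IsRookCocycle.dvv (hs : IsRookCocycle s) {a c : α} {b e f g : β}
    (h1 : a ≠ c) (h2 : b ≠ e) (h3 : e ≠ f) (h4 : f ≠ g) :
    s (a, b) (c, e) (c, f) (c, g) = 0 := by
  have h := hs.rel (a, b) (a, e) (c, e) (c, f) (c, g) (by grind [rookDist]) (by grind [rookDist])
    (by grind [rookDist]) (by grind [rookDist])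
  rw [hs.zero (a, b) (a, e) (c, e) (c, g) (by grind [rookDist]),
    hs.vdv h2 h1 h3 h4] at h
  grind

theorem IsRookCocycle.hvd (hs : IsRookCocycle s) {a c d : α} {b e f : β}
    (h1 : a ≠ c) (h2 : b ≠ e) (h3 : c ≠ d) (h4 : e ≠ f) :
    s (a, b) (c, b) (c, e) (d, f) = s (a, b) (a, e) (c, e) (d, f) := by
  have h := hs.rel (a, b) (c, b) (c, e) (c, f) (d, f) (by grind [rookDist]) (by grind [rookDist])
    (by grind [rookDist]) (by grind [rookDist])
  rw [hs.zero (a, b) (c, b) (c, f) (d, f) (by grind [rookDist]),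
    hs.dvh h1 h2 h3 h4] at h
  grind

/-- No face of the walk `hvhv` is short; the outer two terms, of kinds `dhv` and `hvd`, are opposite
multiples of the same parameter and cancel. -/
theorem IsRookCocycle.hdv (hs : IsRookCocycle s) {a c d : α} {b e f : β}
    (h1 : a ≠ c) (h2 : b ≠ e) (h3 : c ≠ d) (h4 : e ≠ f) :
    s (a, b) (c, b) (d, e) (d, f) = 0 := by
  have h := hs.rel (a, b) (c, b) (c, e) (d, e) (d, f) (by grind [rookDist]) (by grind [rookDist])
    (by grind [rookDist]) (by grind [rookDist])
  rw [hs.dhv h1 h2 h3 h4,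
    hs.hvd h1 h2 h3 h4] at h
  grind

theorem IsRookCocycle.hhd (hs : IsRookCocycle s) {a c d f : α} {b e : β}
    (h1 : a ≠ c) (h2 : c ≠ d) (h3 : d ≠ f) (h4 : b ≠ e) :
    s (a, b) (c, b) (d, b) (f, e) = 0 := by
  have h := hs.rel (a, b) (c, b) (d, b) (d, e) (f, e) (by grind [rookDist]) (by grind [rookDist])
    (by grind [rookDist]) (by grind [rookDist])
  rw [hs.zero (a, b) (d, b) (d, e) (f, e) (by grind [rookDist]),
    hs.hdh h1 h2 h4 h3] at h
  grind

/-- A rook cocycle is determined by its values at the quadruples whose second entry is the chosen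
midpoint of the first and the third. -/
theorem IsRookCocycle.eq_sub (hs : IsRookCocycle s) {x y z w : α × β} (hxy : x ≠ y) (hyz : y ≠ z)
    (hzw : z ≠ w) (hl : rookDist x y + rookDist y z + rookDist z w = 4) :
    s x y z w =
      (if rookDist x z = 2 ∧ rookDist z w = 2 then s x (x.1, z.2) z w else 0) -
        if rookDist x y = 2 ∧ rookDist y w = 2 then s x (x.1, y.2) y w else 0 := by
  obtain ⟨a, b⟩ := x
  obtain ⟨c, d⟩ := y
  obtain ⟨e, f⟩ := z
  obtain ⟨g, h⟩ := w
  have step : ∀ {p q : α} {u v : β}, (p, u) ≠ (q, v) →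
      p = q ∧ u ≠ v ∨ p ≠ q ∧ u = v ∨ p ≠ q ∧ u ≠ v := by
    intro p q u v hne
    rw [ne_eq, Prod.mk.injEq] at hne
    tauto
  -- For two cells sharing a coordinate, `rookDist` simplifies to a single conditional, which cannot
  -- be `2`.
  have two_ne : ∀ (p : Prop) [Decidable p], ¬ (if p then 0 else 1) = 2 := by
    intro p _
    split_ifs <;> simp
  -- Of the 27 combinations of kinds, length four leaves the 12 with exactly one diagonal step.
  rcases step hxy with ⟨rfl, h1⟩ | ⟨h1, rfl⟩ | ⟨h1, h2⟩ <;>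
    rcases step hyz with ⟨rfl, h3⟩ | ⟨h3, rfl⟩ | ⟨h3, h4⟩ <;>
    rcases step hzw with ⟨rfl, h5⟩ | ⟨h5, rfl⟩ | ⟨h5, h6⟩ <;>
    simp only [rookDist, if_true, if_false, *] at hl <;> try omega
  all_goals clear hxy hyz hzw hl step
  · rw [hs.vvd h1 h3 h5 h6]
    simp [rookDist, two_ne]
  -- Kind `vhd`: the second entry already is the chosen midpoint.
  · simp [rookDist, *]
  · rw [hs.vdv h1 h3 h4 h5]
    simp [rookDist, two_ne]
  · rw [hs.vdh h1 h3 h4 h5]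
    simp [rookDist, *]
  · rw [hs.hvd h1 h3 h5 h6]
    simp [rookDist, *]
  · rw [hs.hhd h1 h3 h5 h6]
    simp [rookDist, two_ne]
  · rw [hs.hdv h1 h4 h3 h5]
    simp [rookDist, *]
  · rw [hs.hdh h1 h3 h4 h5]
    simp [rookDist, two_ne]
  · rw [hs.dvv h1 h2 h3 h5]
    simp [rookDist, two_ne]
  · rw [hs.dvh h1 h2 h5 h3]
    simp [rookDist, *]
  · rw [hs.dhv h1 h2 h3 h5]
    simp [rookDist, *]
  · rw [hs.dhh h1 h2 h3 h5]
    simp [rookDist, two_ne]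

end RookHomology

/-! ### Vanishing for the rook graph -/

section RookVanishing

theorem edist_rookGraph (x y : ZMod 4 × ZMod 4) : rookGraph.edist x y = rookDist x y := by
  rw [edist_eq_shortDist rookGraph_diam, shortDist_rookGraph]

/-- Taking values in the cokernel itself turns the computation with cocycles into one with homology
classes over `ℤ`. -/
theorem isRookCocycle_mkQ : IsRookCocycle fun x y z w : ZMod 4 × ZMod 4 =>
    (LinearMap.range (boundary rookGraph 3 4)).mkQ (chainOf rookGraph 3 4 ![x, y, z, w]) where
  zero x y z w h := by
    rw [chainOf, dif_neg, map_zero]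
    rintro ⟨-, hl⟩
    rw [length_vec_three edist_rookGraph] at hl
    exact h (by exact_mod_cast hl)
  rel x y z w v h1 h2 h3 h4 := by
    have ne {x y : ZMod 4 × ZMod 4} (h : rookDist x y = 1) : x ≠ y := by
      rintro rfl
      simp [rookDist] at h
    have hx : ∀ i : Fin 4, ![x, y, z, w, v] i.castSucc ≠ ![x, y, z, w, v] i.succ := by
      intro i
      fin_cases i
      exacts [ne h1, ne h2, ne h3, ne h4]
    have hl : length rookGraph ![x, y, z, w, v] = (4 : ℕ) := by
      rw [length_vec_four edist_rookGraph, h1, h2, h3, h4]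
    have hb := boundary_chainOf_four hx hl
    rw [← map_sub, ← map_add, Submodule.mkQ_apply, Submodule.Quotient.mk_eq_zero]
    -- The alternating sum in `rel` is minus the boundary of the walk.
    refine ⟨-chainOf rookGraph 4 4 ![x, y, z, w, v], ?_⟩
    rw [map_neg, hb]
    simp
    abel

theorem isZero_magnitudeHomology_rookGraph :
    CategoryTheory.Limits.IsZero (magnitudeHomology rookGraph 3 4) := by
  refine isZero_magnitudeHomology rookGraph 2 4 fun c hc => ?_
  let π := (LinearMap.range (boundary rookGraph 3 4)).mkQ
  let s := fun x y z w : ZMod 4 × ZMod 4 => π (chainOf rookGraph 3 4 ![x, y, z, w])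
  let t := fun x y z : ZMod 4 × ZMod 4 => s x (x.1, y.2) y z
  let η := Finsupp.linearCombination ℤ fun g : Gen rookGraph 2 4 => t (g.1 0) (g.1 1) (g.1 2)
  -- Distances are at most two, so a triple of length four consists of two diagonal steps. This is
  -- the source of the conditions in `IsRookCocycle.eq_sub`.
  have hη (x y z : ZMod 4 × ZMod 4) : η (chainOf rookGraph 2 4 ![x, y, z]) =
      if rookDist x y = 2 ∧ rookDist y z = 2 then t x y z else 0 := by
    have le_two (x y : ZMod 4 × ZMod 4) : rookDist x y ≤ 2 := by
      unfold rookDist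
      split_ifs <;> simp
    have ne {x y : ZMod 4 × ZMod 4} (h : rookDist x y = 2) : x ≠ y := by
      rintro rfl
      simp [rookDist] at h
    split_ifs with h
    · have hg : (∀ i : Fin 2, ![x, y, z] i.castSucc ≠ ![x, y, z] i.succ) ∧
          length rookGraph ![x, y, z] = (4 : ℕ) := by
        refine ⟨fun i => ?_, ?_⟩
        · fin_cases i
          exacts [ne h.1, ne h.2]
        · rw [length_vec_two edist_rookGraph, h.1, h.2]
      exact linearCombination_chainOf _ hg
    · rw [chainOf, dif_neg, map_zero]
      rintro ⟨-, hl⟩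
      rw [length_vec_two edist_rookGraph] at hl
      have hl' : rookDist x y + rookDist y z = 4 := by exact_mod_cast hl
      have := le_two x y
      have := le_two y z
      omega
  -- The projection to the cokernel factors through the differential, so it kills every cycle.
  have key : π = -η ∘ₗ boundary rookGraph 2 4 := by
    refine Finsupp.lhom_ext' fun g => LinearMap.ext_ring ?_
    simp only [LinearMap.comp_apply, Finsupp.lsingle_apply, LinearMap.neg_apply]
    have hl := g.2.2
    rw [gen_eq_vec_three, length_vec_three edist_rookGraph] at hl
    have h := isRookCocycle_mkQ.eq_sub (g.2.1 0) (g.2.1 1) (g.2.1 2) (by exact_mod_cast hl)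
    rw [← chainOf_val, boundary_chainOf_three g.2.1 g.2.2, map_sub, hη, hη, neg_sub]
    conv_lhs => rw [gen_eq_vec_three g]
    exact h
  have : π c = 0 := by
    rw [key]
    exact (congrArg (-η) hc).trans (map_zero _)
  rwa [Submodule.mkQ_apply, Submodule.Quotient.mk_eq_zero] at this

end RookVanishing

/-! ### A class of infinite order for the Shrikhande graph -/

section ShrikhandeNonvanishing

/-- A cocycle of the Shrikhande graph in degree `(3, 4)`, as a function on quadruples of vertices.
It is supported on the quadruples from `(0, 0)` to `(0, 2)`. -/
def shrikhandeCocycle (x y z w : ZMod 4 × ZMod 4) : ℤ :=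
  if x = (0, 0) ∧ w = (0, 2) then
    if (y, z) ∈ ([((1, 1), (2, 2)), ((1, 1), (3, 2)), ((2, 1), (3, 2)), ((2, 3), (1, 3)),
      ((3, 0), (1, 3)), ((3, 0), (2, 0))] : List ((ZMod 4 × ZMod 4) × (ZMod 4 × ZMod 4))) then 1
    else if (y, z) ∈ ([((1, 0), (2, 1)), ((1, 0), (3, 1)), ((2, 0), (3, 1)), ((2, 2), (1, 2)),
      ((3, 3), (1, 2)), ((3, 3), (2, 3))] : List ((ZMod 4 × ZMod 4) × (ZMod 4 × ZMod 4))) then -1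
    else 0
  else 0

/-- Being zero off the generators, the cocycle agrees with the functional it defines even at
inadmissible sequences, where `chainOf` is zero. The cocycle relation therefore needs no case
distinction on which faces survive. -/
theorem shrikhandeCocycle_support (y z : ZMod 4 × ZMod 4) :
    shrikhandeCocycle (0, 0) y z (0, 2) = 0 ∨ ((0, 0) ≠ y ∧ y ≠ z ∧ z ≠ (0, 2)) ∧
      shortDist shrikhandeGraph (0, 0) y + shortDist shrikhandeGraph y z +
        shortDist shrikhandeGraph z (0, 2) = 4 := by
  revert y z
  decide +kernel

/-- The differential fixes both endpoints, so only walks of four edges from `(0, 0)` to `(0, 2)`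
have to be tested; there are finitely many. -/
theorem shrikhandeCocycle_rel (y : ZMod 4 × ZMod 4) : shrikhandeGraph.Adj (0, 0) y →
    ∀ w, shrikhandeGraph.Adj w (0, 2) → ∀ z, shrikhandeGraph.Adj y z → shrikhandeGraph.Adj z w →
      -shrikhandeCocycle (0, 0) z w (0, 2) + shrikhandeCocycle (0, 0) y w (0, 2) -
        shrikhandeCocycle (0, 0) y z (0, 2) = 0 := by
  revert y
  decide +kernel

theorem rank_magnitudeHomology_shrikhandeGraph :
    Module.rank ℤ (magnitudeHomology shrikhandeGraph 3 4) ≠ 0 := by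
  have hd := edist_eq_shortDist shrikhandeGraph_diam
  let f := shrikhandeCocycle
  let φ := Finsupp.linearCombination ℤ fun g : Gen shrikhandeGraph 3 4 =>
    f (g.1 0) (g.1 1) (g.1 2) (g.1 3)
  have f_eq_zero {x w : ZMod 4 × ZMod 4} (h : ¬ (x = (0, 0) ∧ w = (0, 2))) (y z) :
      f x y z w = 0 := if_neg h
  have hφ (x y z w : ZMod 4 × ZMod 4) :
      φ (chainOf shrikhandeGraph 3 4 ![x, y, z, w]) = f x y z w := by
    by_cases hg : (∀ i : Fin 3, ![x, y, z, w] i.castSucc ≠ ![x, y, z, w] i.succ) ∧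
        length shrikhandeGraph ![x, y, z, w] = (4 : ℕ)
    · exact linearCombination_chainOf _ hg
    · rw [chainOf, dif_neg hg, map_zero]
      by_cases hxw : x = (0, 0) ∧ w = (0, 2)
      · obtain ⟨rfl, rfl⟩ := hxw
        rcases shrikhandeCocycle_support y z with h | ⟨⟨h1, h2, h3⟩, h4⟩
        · exact h.symm
        · refine absurd ⟨fun i => ?_, ?_⟩ hg
          · fin_cases i
            exacts [h1, h2, h3]
          · rw [length_vec_three hd, h4]
      · exact (f_eq_zero hxw y z).symm
  -- The steps of this sequence have lengths 1, 2, 1, and omitting either interior vertex drops the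
  -- total to 3. Hence the generator alone is a cycle; the cocycle takes the value `-1` on it.
  have hz : (∀ i : Fin 3, (![(0, 0), (3, 3), (1, 2), (0, 2)] : Fin 4 → ZMod 4 × ZMod 4) i.castSucc ≠
      (![(0, 0), (3, 3), (1, 2), (0, 2)] : Fin 4 → ZMod 4 × ZMod 4) i.succ) ∧
      shortDist shrikhandeGraph (0, 0) (3, 3) + shortDist shrikhandeGraph (3, 3) (1, 2) +
        shortDist shrikhandeGraph (1, 2) (0, 2) = 4 ∧
      shortDist shrikhandeGraph (0, 0) (3, 3) + shortDist shrikhandeGraph (3, 3) (0, 2) ≠ 4 ∧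
      shortDist shrikhandeGraph (0, 0) (1, 2) + shortDist shrikhandeGraph (1, 2) (0, 2) ≠ 4 ∧
      shrikhandeCocycle (0, 0) (3, 3) (1, 2) (0, 2) ≠ 0 := by
    decide +kernel
  have hface (x y z : ZMod 4 × ZMod 4)
      (h : shortDist shrikhandeGraph x y + shortDist shrikhandeGraph y z ≠ 4) :
      chainOf shrikhandeGraph 2 4 ![x, y, z] = 0 := by
    refine dif_neg fun h' => h ?_
    have hl := h'.2
    rw [length_vec_two hd] at hl
    exact_mod_cast hl
  refine rank_magnitudeHomology_ne_zero shrikhandeGraph 2 4 φ ?_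
    (chainOf shrikhandeGraph 3 4 ![(0, 0), (3, 3), (1, 2), (0, 2)]) ?_ ?_
  · refine Finsupp.lhom_ext' fun g => LinearMap.ext_ring ?_
    simp only [LinearMap.comp_apply, Finsupp.lsingle_apply, LinearMap.zero_apply]
    rw [← chainOf_val, boundary_chainOf_four g.2.1 g.2.2, map_sub, map_add, map_neg, hφ, hφ, hφ]
    by_cases hxw : g.1 0 = (0, 0) ∧ g.1 4 = (0, 2)
    · have hl := g.2.2
      rw [gen_eq_vec_four, length_vec_four hd] at hl
      have hl' : shortDist shrikhandeGraph (g.1 0) (g.1 1) +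
          shortDist shrikhandeGraph (g.1 1) (g.1 2) + shortDist shrikhandeGraph (g.1 2) (g.1 3) +
          shortDist shrikhandeGraph (g.1 3) (g.1 4) = 4 := by
        exact_mod_cast hl
      -- Four steps of length at least one with total four are all edges.
      have pos {x y : ZMod 4 × ZMod 4} (h : x ≠ y) : 1 ≤ shortDist shrikhandeGraph x y := by
        unfold shortDist
        split_ifs <;> simp_all
      have adj {x y : ZMod 4 × ZMod 4} (h : shortDist shrikhandeGraph x y = 1) :
          shrikhandeGraph.Adj x y := by
        unfold shortDist at h
        split_ifs at h
        · assumption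
        · contradiction
      have p0 := pos (g.2.1 0)
      have p1 := pos (g.2.1 1)
      have p2 := pos (g.2.1 2)
      have p3 := pos (g.2.1 3)
      simp only [Fin.isValue, Fin.castSucc_zero, Fin.succ_zero_eq_one, Fin.castSucc_one,
        Fin.succ_one_eq_two, Fin.reduceCastSucc, Fin.reduceSucc] at p0 p1 p2 p3
      have a0 := adj (x := g.1 0) (y := g.1 1) (by omega)
      have a1 := adj (x := g.1 1) (y := g.1 2) (by omega)
      have a2 := adj (x := g.1 2) (y := g.1 3) (by omega)
      have a3 := adj (x := g.1 3) (y := g.1 4) (by omega)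
      rw [hxw.1] at a0 ⊢
      rw [hxw.2] at a3 ⊢
      exact shrikhandeCocycle_rel _ a0 _ a3 _ a1 a2
    · simp only [f_eq_zero hxw]
      simp
  · rw [boundary_chainOf_three hz.1 (by rw [length_vec_three hd, hz.2.1])]
    exact (congrArg₂ _ (hface _ _ _ hz.2.2.1) (hface _ _ _ hz.2.2.2.1)).trans (sub_zero 0)
  · rw [hφ]
    exact hz.2.2.2.2

end ShrikhandeNonvanishing

end GraphMagnitude

theorem mainTheorem7 :
    (GraphMagnitude.magnitude GraphMagnitude.rookGraph =
        GraphMagnitude.magnitude GraphMagnitude.shrikhandeGraph ∧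
      GraphMagnitude.magnitude GraphMagnitude.rookGraph =
        16 / (1 + 6 * RatFunc.X + 9 * RatFunc.X ^ 2)) ∧
    (GraphMagnitude.magnitudeSeries GraphMagnitude.rookGraph =
        GraphMagnitude.magnitudeSeries GraphMagnitude.shrikhandeGraph ∧
      GraphMagnitude.magnitudeSeries GraphMagnitude.rookGraph *
        (1 + 6 * PowerSeries.X + 9 * PowerSeries.X ^ 2) = 16) ∧
    CategoryTheory.Limits.IsZero
      (GraphMagnitude.magnitudeHomology GraphMagnitude.rookGraph 3 4) ∧
    Module.rank ℤ (GraphMagnitude.magnitudeHomology GraphMagnitude.shrikhandeGraph 3 4) ≠ 0 ∧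
    ¬ ∀ k l : ℕ, Nonempty (CategoryTheory.Iso
      (GraphMagnitude.magnitudeHomology GraphMagnitude.rookGraph k l)
      (GraphMagnitude.magnitudeHomology GraphMagnitude.shrikhandeGraph k l)) := by
  open GraphMagnitude in
  have hr := magnitudeAt_rookGraph_mul _ (isUnit_det_similarityMatrix_ratFunc rookGraph)
  open GraphMagnitude in
  have hs := magnitudeAt_shrikhandeGraph_mul _ (isUnit_det_similarityMatrix_ratFunc shrikhandeGraph)
  open GraphMagnitude in
  have hr' := magnitudeAt_rookGraph_mul _ (isUnit_det_similarityMatrix_series rookGraph)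
  open GraphMagnitude in
  have hs' := magnitudeAt_shrikhandeGraph_mul _ (isUnit_det_similarityMatrix_series shrikhandeGraph)
  refine ⟨⟨mul_right_cancel₀ GraphMagnitude.ratFunc_denominator_ne_zero (hr.trans hs.symm),
    (eq_div_iff GraphMagnitude.ratFunc_denominator_ne_zero).mpr hr⟩,
    ⟨mul_right_cancel₀ GraphMagnitude.powerSeries_denominator_ne_zero (hr'.trans hs'.symm), hr'⟩,
    GraphMagnitude.isZero_magnitudeHomology_rookGraph,
    GraphMagnitude.rank_magnitudeHomology_shrikhandeGraph, fun h => ?_⟩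
  obtain ⟨i⟩ := h 3 4
  have := ModuleCat.subsingleton_of_isZero
    (GraphMagnitude.isZero_magnitudeHomology_rookGraph.of_iso i.symm)
  exact GraphMagnitude.rank_magnitudeHomology_shrikhandeGraph (rank_subsingleton' ℤ _)
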